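/- A tree is a partially ordered set $T$ in which $\{s\in T: s<t\}$ is well ordered for every $t\in T$; the order type of this set is the level of $t$, and the height of $T$ is $\sup\{\mathrm{level}(t)+1:t\in T\}$. Let $T$ be an Aronszajn tree, i.e. a tree of height $\omega_1$ in which every level and every chain is countable, and suppose that any two nodes at the same (nonzero) limit level with the same set of predecessors are equal. Give $T$ the interval topology, generated by the sets $(s,t]=\{x\in T: s<x\le t\}$ for $s<t$ in $T$ and the sets $(-\infty,t]=\{x\in T:x\le t\}$ for $t\in T$, and let $X=T\cup\{\infty\}$ be its one-point compactification. Then: 1. $X$ is Fréchet: whenever $x\in\overline{A}$ with $A\subseteq X$, some sequence of points of $A$ converges to $x$. 2. $X$ is $CFC$: every countable subspace of $X$ is first countable. 3. $X$ is strongly $C$-selective: for every countable regular $T_1$ space $Y$ and every map $\varphi$ from $Y$ to the nonempty subsets of $X$ that is lower semicontinuous (i.e. $\{y\in Y:\varphi(y)\cap U\ne\emptyset\}$ is open for each open $U\subseteq X$), there is a continuous $f:Y\to X$ with $f(y)\in\varphi(y)$ for all $y\in Y$. 4. $X$ is not a $W$-space. Here $X$ is a $W$-space if at every point $x\in X$ player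 I has a winning strategy in the following game: in round $n\in\{0,1,2,\dots\}$ player I chooses an open set $U_n$ containing $x$ and then player II chooses a point $x_n\in U_n$; player I wins if the sequence $(x_n)$ converges to $x$. -/

import Mathlib

open scoped Ordinal Topology

universe v u

/-- A tree in the sense of set theory: a partial order in which the set of strict predecessors of
every node is well ordered by `<`. (Several minimal elements are allowed.) -/
class IsOrderTree (T : Type*) [PartialOrder T] : Prop where
  isWellOrder_Iio : ∀ t : T, IsWellOrder (Set.Iio t) (· < ·)

namespace IsOrderTree

instance {T : Type*} [PartialOrder T] [IsOrderTree T] (t : T) :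
    IsWellOrder (Set.Iio t) (· < ·) :=
  isWellOrder_Iio t

/-- The level of a node `t`: the order type of its set of strict predecessors. -/
noncomputable def level {T : Type*} [PartialOrder T] [IsOrderTree T] (t : T) : Ordinal :=
  @Ordinal.type (Set.Iio t) (· < ·) inferInstance

/-- The height of a tree: the supremum of the ordinals `level t + 1` over all nodes `t`. -/
noncomputable def height (T : Type*) [PartialOrder T] [IsOrderTree T] : Ordinal :=
  ⨆ t : T, Order.succ (level t)

end IsOrderTree

/-- An Aronszajn tree: a tree of height `ω₁` all of whose levels and chains are countable. -/
structure IsAronszajnTree (T : Type*) [PartialOrder T] [IsOrderTree T] : Prop where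
  height_eq : IsOrderTree.height T = ω₁
  countable_level : ∀ α : Ordinal, {t : T | IsOrderTree.level t = α}.Countable
  countable_chain : ∀ c : Set T, IsChain (· ≤ ·) c → c.Countable

/-- Two nodes at the same (nonzero) limit level with the same predecessors are equal. -/
def HasUniqueLimitNodes (T : Type*) [PartialOrder T] [IsOrderTree T] : Prop :=
  ∀ s t : T, IsOrderTree.level s = IsOrderTree.level t →
    Order.IsSuccLimit (IsOrderTree.level s) → Set.Iio s = Set.Iio t → s = t

/-- The interval topology of a tree, generated by the half-open intervals `(s, t]` with `s < t`
and the initial intervals `(-∞, t]`. The latter only add to the former that minimal nodes are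
isolated. -/
@[reducible] def treeIntervalTopology (T : Type*) [PartialOrder T] : TopologicalSpace T :=
  TopologicalSpace.generateFrom
    ({U | ∃ s t : T, s < t ∧ U = Set.Ioc s t} ∪ {U | ∃ t : T, U = Set.Iic t})

/-- `X` is CFC: every countable subspace is first countable. -/
def IsCFC (X : Type*) [TopologicalSpace X] : Prop :=
  ∀ S : Set X, S.Countable → FirstCountableTopology S

/-- `X` is strongly `Y`-selective: every lower semicontinuous map from `Y` to the nonempty subsets
of `X` has a continuous selection. Mathlib's `LowerHemicontinuous φ` says that
`{y | (φ y ∩ U).Nonempty}` is open for every open `U`, see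
`lowerHemicontinuous_iff_isOpen_inter_nonempty`. -/
def IsStronglySelective (Y X : Type*) [TopologicalSpace Y] [TopologicalSpace X] : Prop :=
  ∀ φ : Y → Set X, (∀ y, (φ y).Nonempty) → LowerHemicontinuous φ →
    ∃ f : Y → X, Continuous f ∧ ∀ y, f y ∈ φ y

/-- `X` is strongly `C`-selective: strongly `Y`-selective for every countable regular `T₁`
space `Y`. -/
def IsStronglyCSelective (X : Type u) [TopologicalSpace X] : Prop :=
  ∀ (Y : Type v) [TopologicalSpace Y] [Countable Y] [T3Space Y], IsStronglySelective Y X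

/-- A winning strategy for player I (the open-set picker) in the `W`-game at `x`. In round `n`
the strategy sees the points `p 0, …, p (n - 1)` played so far by player II, and answers with an
open neighbourhood of `x`, from which player II has to choose `p n`. Player I wins if
the sequence `p` converges to `x`. -/
def IsWinningWStrategy {X : Type*} [TopologicalSpace X] (x : X)
    (σ : (n : ℕ) → (Fin n → X) → Set X) : Prop :=
  (∀ (n : ℕ) (h : Fin n → X), IsOpen (σ n h) ∧ x ∈ σ n h) ∧
    ∀ p : ℕ → X, (∀ n, p n ∈ σ n (fun i => p i)) → Filter.Tendsto p Filter.atTop (𝓝 x)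

/-- `X` is a `W`-space: at every point player I has a winning strategy in the `W`-game. -/
def IsWSpace (X : Type*) [TopologicalSpace X] : Prop :=
  ∀ x : X, ∃ σ : (n : ℕ) → (Fin n → X) → Set X, IsWinningWStrategy x σ

/-! ### Levels and countability in Aronszajn trees. -/

section Order

variable {T : Type*} [PartialOrder T] [IsOrderTree T]

namespace IsOrderTree

/-! Cones `Iic t` are compact and clopen, so the complements of finite unions of cones form a
neighbourhood base at ∞; a node has a countable base because it has countably many predecessors. All
the work is therefore at ∞, and a sequence of nodes tends to ∞ iff it eventually leaves every cone.

Fréchet: a set not covered by finitely many cones is either a finite union of chains, one of which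
meets it in a countable chain lying in no cone, or contains an infinite antichain, which meets each
cone at most once.

CFC: cones have only countably many traces on a countable set `S`. If `Iic t` leaves the
down-closure of `S`, it has the same trace as `Iic m`, with `m` its first node outside, and there
are countably many such `m`.

Selection: by the dichotomy above, a carrier restricts to a countable subspace without losing lower
semicontinuity. That subspace is first countable, which suffices for Michael's theorem over
countable domains.

Not W: a countable set `C` of nodes is closed off under a strategy at ∞. Below a minimal node `t`
outside `C`, player II always has a legal move, so the play never leaves `Iic t`. -/

instance wellFoundedLT : WellFoundedLT T := by
  refine ⟨WellFounded.wellFounded_iff_has_min.2 fun A ⟨a, ha⟩ => ?_⟩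
  by_cases h : ∃ x ∈ A, x < a
  · obtain ⟨x, hx, hxa⟩ := h
    obtain ⟨m, hm, hmin⟩ := (isWellOrder_Iio a).toIsWellFounded.wf.has_min
      {y : Set.Iio a | (y : T) ∈ A} ⟨⟨x, hxa⟩, hx⟩
    exact ⟨m, hm, fun y hy hym => hmin ⟨y, hym.trans m.2⟩ hy hym⟩
  · push Not at h
    exact ⟨a, ha, h⟩

theorem exists_min {A : Set T} (h : A.Nonempty) : ∃ m ∈ A, ∀ x ∈ A, ¬ x < m :=
  (wellFounded_lt (α := T)).has_min A h

theorem exists_min_le {A : Set T} {a : T} (h : a ∈ A) : ∃ m ∈ A, m ≤ a ∧ ∀ x ∈ A, ¬ x < m := by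
  obtain ⟨m, ⟨hm, hma⟩, hmin⟩ := exists_min (A := A ∩ Set.Iic a) ⟨a, h, le_rfl⟩
  exact ⟨m, hm, hma, fun x hx hxm => hmin x ⟨hx, hxm.le.trans hma⟩ hxm⟩

theorem le_or_ge_of_lt {x y t : T} (hx : x < t) (hy : y < t) : x ≤ y ∨ y ≤ x := by
  by_contra! h
  have := (isWellOrder_Iio t).toTrichotomous.trichotomous ⟨x, hx⟩ ⟨y, hy⟩
    (fun h' => h.1 (le_of_lt h')) (fun h' => h.2 (le_of_lt h'))
  exact h.1 (le_of_eq (congrArg Subtype.val this))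

theorem le_or_ge_of_le {x y t : T} (hx : x ≤ t) (hy : y ≤ t) : x ≤ y ∨ y ≤ x := by
  rcases hx.eq_or_lt with rfl | hx
  · exact Or.inr hy
  rcases hy.eq_or_lt with rfl | hy
  · exact Or.inl hx.le
  exact le_or_ge_of_lt hx hy

theorem isChain_Iic (t : T) : IsChain (· ≤ ·) (Set.Iic t) :=
  fun _ hx _ hy _ => le_or_ge_of_le hx hy

theorem level_eq_typein {x t : T} (h : x < t) :
    level x = Ordinal.typein (α := Set.Iio t) (· < ·) ⟨x, h⟩ := by
  rw [← Ordinal.type_subrel]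
  refine Ordinal.type_eq.2 ⟨⟨⟨fun y => ⟨⟨y, lt_trans y.2 h⟩, y.2⟩, fun y => ⟨y.1, y.2⟩,
    fun _ => rfl, fun _ => rfl⟩, Iff.rfl⟩⟩

theorem level_lt_level {x t : T} (h : x < t) : level x < level t := by
  rw [level_eq_typein h]
  exact Ordinal.typein_lt_type _ _

theorem exists_lt_level_eq {t : T} {β : Ordinal} (h : β < level t) :
    ∃ x < t, level x = β := by
  obtain ⟨⟨x, hx⟩, rfl⟩ := Ordinal.typein_surj _ h
  exact ⟨x, hx, level_eq_typein hx⟩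

theorem isSuccLimit_level {t : T} (h₀ : (Set.Iio t).Nonempty)
    (h : ∀ x < t, ∃ y < t, x < y) : Order.IsSuccLimit (level t) := by
  constructor
  · obtain ⟨x, hx⟩ := h₀
    exact fun hm => (level_lt_level hx).not_ge (hm (level_lt_level hx).le)
  · intro β hβ
    obtain ⟨x, hx, rfl⟩ := exists_lt_level_eq hβ.lt
    obtain ⟨y, hy, hxy⟩ := h x hx
    exact hβ.2 (level_lt_level hxy) (level_lt_level hy)

end IsOrderTree

open IsOrderTree

theorem IsAronszajnTree.countable_Iio (hA : IsAronszajnTree T) (t : T) :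
    (Set.Iio t).Countable :=
  hA.countable_chain _ ((isChain_Iic t).mono Set.Iio_subset_Iic_self)

theorem IsAronszajnTree.countable_Iic (hA : IsAronszajnTree T) (t : T) :
    (Set.Iic t).Countable :=
  hA.countable_chain _ (isChain_Iic t)

theorem IsAronszajnTree.succ_level_lt (hA : IsAronszajnTree T) (t : T) :
    Order.succ (level t) < ω₁ := by
  refine (Cardinal.isSuccLimit_omega 1).succ_lt ?_
  rw [← Cardinal.ord_aleph, Cardinal.lt_ord, level, Ordinal.card_type, ← Cardinal.succ_aleph0,
    Order.lt_succ_iff, Cardinal.le_aleph0_iff_set_countable]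
  exact hA.countable_Iio t

theorem IsAronszajnTree.not_countable (hA : IsAronszajnTree T) : ¬ Countable T := fun _ =>
  (Ordinal.iSup_lt_omega_one hA.succ_level_lt).ne hA.height_eq

/-- The levels of such nodes are bounded by the countable ordinal `sup {level s + 1 : s ∈ S}`, and
each level is countable. -/
theorem IsAronszajnTree.countable_setOf_Iio_subset (hA : IsAronszajnTree T) {S : Set T}
    (hS : S.Countable) : {t : T | Set.Iio t ⊆ S}.Countable := by
  have := hS.to_subtype
  set α : Ordinal := ⨆ s : S, Order.succ (level (s : T)) with hα
  have hlt : α < ω₁ := Ordinal.iSup_lt_omega_one fun s : S => hA.succ_level_lt s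
  have hc : (Set.Iic α).Countable := by
    rw [← Order.Iio_succ, ← Cardinal.le_aleph0_iff_set_countable, Cardinal.mk_Iio_ordinal,
      Cardinal.lift_le_aleph0, ← Order.lt_succ_iff, Cardinal.succ_aleph0, ← Cardinal.lt_ord,
      Cardinal.ord_aleph]
    exact (Cardinal.isSuccLimit_omega 1).succ_lt hlt
  refine (hc.biUnion fun β _ => hA.countable_level β).mono fun t ht => ?_
  simp only [Set.mem_iUnion, Set.mem_Iic, Set.mem_ofPred_eq, exists_prop, exists_eq_right']
  by_contra! h
  obtain ⟨x, hx, hxα⟩ := exists_lt_level_eq h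
  have h1 : Order.succ (level x) ≤ α :=
    le_ciSup (f := fun s : S => Order.succ (level (s : T))) Ordinal.bddAbove_of_small ⟨x, ht hx⟩
  rw [hxα] at h1
  exact (Order.lt_succ α).not_ge h1

end Order

/-! ### Finite unions of chains, infinite antichains and cones. -/

section Chains

open IsOrderTree

/-- A finite union of chains. -/
def IsFiniteUnionOfChains {T : Type*} [PartialOrder T] (A : Set T) : Prop :=
  ∃ F : Set (Set T), F.Finite ∧ (∀ c ∈ F, IsChain (· ≤ ·) c) ∧ A ⊆ ⋃₀ F

namespace IsFiniteUnionOfChains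

variable {T : Type*} [PartialOrder T]

theorem of_isChain {A : Set T} (h : IsChain (· ≤ ·) A) : IsFiniteUnionOfChains A :=
  ⟨{A}, Set.finite_singleton A, by simpa, by simp⟩

theorem mono {A B : Set T} (h : IsFiniteUnionOfChains B) (hAB : A ⊆ B) :
    IsFiniteUnionOfChains A := by
  obtain ⟨F, hF, hc, hB⟩ := h
  exact ⟨F, hF, hc, hAB.trans hB⟩

theorem biUnion {ι : Type*} {s : Set ι} (hs : s.Finite) {A : ι → Set T}
    (h : ∀ i ∈ s, IsFiniteUnionOfChains (A i)) : IsFiniteUnionOfChains (⋃ i ∈ s, A i) := by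
  choose! F hF hc hA using h
  refine ⟨⋃ i ∈ s, F i, hs.biUnion hF, ?_, ?_⟩
  · simp only [Set.mem_iUnion]
    rintro c ⟨i, hi, hci⟩
    exact hc i hi c hci
  · refine Set.iUnion₂_subset fun i hi => (hA i hi).trans ?_
    exact Set.sUnion_subset_sUnion (Set.subset_biUnion_of_mem (u := F) hi)

theorem union {A B : Set T} (hA : IsFiniteUnionOfChains A) (hB : IsFiniteUnionOfChains B) :
    IsFiniteUnionOfChains (A ∪ B) := by
  obtain ⟨F, hF, hc, hA⟩ := hA
  obtain ⟨G, hG, hd, hB⟩ := hB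
  refine ⟨F ∪ G, hF.union hG, ?_, ?_⟩
  · rintro c (h | h)
    exacts [hc c h, hd c h]
  · rw [Set.sUnion_union]
    exact Set.union_subset_union hA hB

end IsFiniteUnionOfChains

variable {T : Type*} [PartialOrder T] [IsOrderTree T]

/-- Otherwise the nodes with a large part of `B` above them form a chain, and the rest of `B` lies
above its minimal elements, which form a finite antichain. Then `B` would be a finite union of
chains. -/
theorem exists_incomparable_of_not_isFiniteUnionOfChains {B : Set T}
    (hB : ¬ IsFiniteUnionOfChains B)
    (hfin : ∀ M ⊆ B, IsAntichain (· ≤ ·) M → M.Finite) :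
    ∃ y ∈ B, ∃ z ∈ B, ¬ y ≤ z ∧ ¬ z ≤ y ∧ ¬ IsFiniteUnionOfChains (B ∩ Set.Ici z) := by
  by_contra! h
  set C : Set T := {z ∈ B | ¬ IsFiniteUnionOfChains (B ∩ Set.Ici z)} with hC
  have hchain : IsChain (· ≤ ·) C := by
    intro y hy z hz _
    by_contra! hyz
    exact hz.2 (h y hy.1 z hz.1 hyz.1 hyz.2)
  set M : Set T := {m ∈ B \ C | ∀ x ∈ B \ C, ¬ x < m} with hM
  have hMfin : M.Finite := by
    refine hfin M (fun m hm => hm.1.1) fun x hx y hy hne hxy => ?_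
    exact hy.2 x hx.1 (lt_of_le_of_ne hxy hne)
  have hbi : IsFiniteUnionOfChains (⋃ m ∈ M, B ∩ Set.Ici m) := by
    refine .biUnion hMfin fun m hm => ?_
    by_contra hm'
    exact hm.1.2 ⟨hm.1.1, hm'⟩
  refine hB (((IsFiniteUnionOfChains.of_isChain hchain).union hbi).mono fun x hx => ?_)
  by_cases hxC : x ∈ C
  · exact Or.inl hxC
  · obtain ⟨m, hm, hmx, hmin⟩ := exists_min_le (A := B \ C) ⟨hx, hxC⟩
    exact Or.inr (Set.mem_biUnion (x := m) ⟨hm, hmin⟩ ⟨hx, hmx⟩)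

/-- In a tree, a set without infinite antichains is a finite union of chains. -/
theorem exists_infinite_antichain_of_not_isFiniteUnionOfChains {A : Set T}
    (hA : ¬ IsFiniteUnionOfChains A) :
    ∃ M ⊆ A, IsAntichain (· ≤ ·) M ∧ M.Infinite := by
  by_contra! hfin
  have step : ∀ B : {B : Set T // B ⊆ A ∧ ¬ IsFiniteUnionOfChains B},
      ∃ y ∈ B.1, ∃ z ∈ B.1, ¬ y ≤ z ∧ ¬ z ≤ y ∧ ¬ IsFiniteUnionOfChains (B.1 ∩ Set.Ici z) :=
    fun B => exists_incomparable_of_not_isFiniteUnionOfChains B.2.2 fun M hM hanti =>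
      hfin M (hM.trans B.2.1) hanti
  choose y hy z hz hyz hzy hnext using step
  -- Every later `y` lies above the current `z`, which is incomparable with the current `y`; hence
  -- the `y (B n)` form an antichain.
  let B : ℕ → {B : Set T // B ⊆ A ∧ ¬ IsFiniteUnionOfChains B} := fun n =>
    Nat.rec ⟨A, subset_rfl, hA⟩
      (fun _ B => ⟨B.1 ∩ Set.Ici (z B), Set.inter_subset_left.trans B.2.1, hnext B⟩) n
  have hsucc : ∀ n, (B (n + 1)).1 = (B n).1 ∩ Set.Ici (z (B n)) := fun n => rfl
  have hanti : Antitone fun n => (B n).1 :=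
    antitone_nat_of_succ_le fun n => (hsucc n).le.trans Set.inter_subset_left
  have key : ∀ {m n}, m < n → ¬ y (B m) ≤ y (B n) ∧ ¬ y (B n) ≤ y (B m) := by
    intro m n hmn
    have h1 : y (B n) ∈ (B (m + 1)).1 := hanti hmn (hy (B n))
    rw [hsucc] at h1
    have h2 : z (B m) ≤ y (B n) := h1.2
    refine ⟨fun h => ?_, fun h => hzy _ (h2.trans h)⟩
    rcases le_or_ge_of_le h h2 with h | h
    exacts [hyz _ h, hzy _ h]
  have hinc : ∀ m n, m ≠ n → ¬ y (B m) ≤ y (B n) := by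
    intro m n hmn
    rcases hmn.lt_or_gt with h | h
    exacts [(key h).1, (key h).2]
  refine (Set.infinite_range_of_injective (f := fun n => y (B n)) fun m n hmn => ?_)
    (hfin _ ?_ ?_)
  · by_contra h
    exact hinc m n h (le_of_eq hmn)
  · rintro _ ⟨n, rfl⟩
    exact (B n).2.1 (hy (B n))
  · rintro _ ⟨m, rfl⟩ _ ⟨n, rfl⟩ hne
    exact hinc m n fun h => hne (by rw [h])

theorem IsAronszajnTree.countable_of_isFiniteUnionOfChains (hA : IsAronszajnTree T) {A : Set T}
    (h : IsFiniteUnionOfChains A) : A.Countable := by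
  obtain ⟨F, hF, hc, hAF⟩ := h
  exact (hF.countable.sUnion fun c hcF => hA.countable_chain c (hc c hcF)).mono hAF

/-- A set not covered by finitely many cones `Iic t` contains a sequence that leaves every cone. -/
theorem IsAronszajnTree.exists_seq_eventually_not_le (hT : IsAronszajnTree T) {A : Set T}
    (hA : ∀ F : Set T, F.Finite → ¬ A ⊆ ⋃ t ∈ F, Set.Iic t) :
    ∃ p : ℕ → T, (∀ n, p n ∈ A) ∧ ∀ t, ∀ᶠ n in Filter.atTop, ¬ p n ≤ t := by
  obtain ⟨t₀⟩ : Nonempty T := by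
    by_contra h
    exact hA ∅ Set.finite_empty fun x _ => (h ⟨x⟩).elim
  by_cases hfuc : IsFiniteUnionOfChains A
  · obtain ⟨F, hF, hc, hAF⟩ := hfuc
    have hex : ∃ c ∈ F, ∀ t, ¬ A ∩ c ⊆ Set.Iic t := by
      by_contra! h
      have : Nonempty T := ⟨t₀⟩
      choose! b hb using h
      refine hA (b '' F) (hF.image b) fun x hx => ?_
      obtain ⟨c, hcF, hxc⟩ := hAF hx
      exact Set.mem_biUnion (Set.mem_image_of_mem b hcF) (hb c hcF ⟨hx, hxc⟩)
    obtain ⟨c, hcF, hunb⟩ := hex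
    have hchain : IsChain (· ≤ ·) (A ∩ c) := (hc c hcF).mono Set.inter_subset_right
    have hne : (A ∩ c).Nonempty := by
      by_contra h
      rw [Set.not_nonempty_iff_eq_empty] at h
      exact hunb t₀ (by simp [h])
    obtain ⟨e, he⟩ := (hT.countable_chain _ hchain).exists_eq_range hne
    have hmem : ∀ n, e n ∈ A ∩ c := fun n => he ▸ Set.mem_range_self n
    -- Running maxima of the enumeration are cofinal in the chain.
    have hmax : ∀ n, ∃ x ∈ A ∩ c, ∀ i ≤ n, e i ≤ x := by
      intro n
      induction n with
      | zero => exact ⟨e 0, hmem 0, fun i hi => by rw [Nat.le_zero.1 hi]⟩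
      | succ n ih =>
        obtain ⟨x, hx, hle⟩ := ih
        rcases hchain.total hx (hmem (n + 1)) with h | h
        · refine ⟨e (n + 1), hmem _, fun i hi => ?_⟩
          rcases Nat.le_succ_iff.1 hi with hi | rfl
          exacts [(hle i hi).trans h, le_rfl]
        · refine ⟨x, hx, fun i hi => ?_⟩
          rcases Nat.le_succ_iff.1 hi with hi | rfl
          exacts [hle i hi, h]
    choose p hp hle using hmax
    refine ⟨p, fun n => (hp n).1, fun t => ?_⟩
    have : ∃ i, ¬ e i ≤ t := by
      by_contra! h
      exact hunb t (he ▸ Set.range_subset_iff.2 h)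
    obtain ⟨i, hi⟩ := this
    filter_upwards [Filter.eventually_ge_atTop i] with n hn h
    exact hi ((hle n i hn).trans h)
  · obtain ⟨M, hMA, hanti, hinf⟩ := exists_infinite_antichain_of_not_isFiniteUnionOfChains hfuc
    have hinj := (hinf.natEmbedding M).injective
    refine ⟨fun n => hinf.natEmbedding M n, fun n => hMA (hinf.natEmbedding M n).2, fun t => ?_⟩
    by_cases h : ∃ i, (hinf.natEmbedding M i : T) ≤ t
    · obtain ⟨i, hi⟩ := h
      filter_upwards [Filter.eventually_gt_atTop i] with n hn hnt
      have hne : (hinf.natEmbedding M i : T) ≠ hinf.natEmbedding M n :=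
        fun h => hn.ne (hinj (Subtype.ext h))
      rcases le_or_ge_of_le hi hnt with h | h
      · exact hanti (hinf.natEmbedding M i).2 (hinf.natEmbedding M n).2 hne h
      · exact hanti (hinf.natEmbedding M n).2 (hinf.natEmbedding M i).2 hne.symm h
    · push Not at h
      exact Filter.Eventually.of_forall h

/-- A cone is a chain, so it contains at most one element of `M`. -/
theorem IsAntichain.not_subset_biUnion_Iic {M F : Set T} (hM : IsAntichain (· ≤ ·) M)
    (hinf : M.Infinite) (hF : F.Finite) : ¬ M ⊆ ⋃ t ∈ F, Set.Iic t := by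
  intro h
  refine hinf ((hF.biUnion fun t _ => ?_ : (⋃ t ∈ F, M ∩ Set.Iic t).Finite).subset
    fun x hx => ?_)
  · refine Set.Subsingleton.finite fun x hx y hy => ?_
    rcases le_or_ge_of_le hx.2 hy.2 with h | h
    exacts [hM.eq hx.1 hy.1 h, (hM.eq hy.1 hx.1 h).symm]
  · obtain ⟨t, ht, hxt⟩ := Set.mem_iUnion₂.1 (h hx)
    exact Set.mem_biUnion ht ⟨hx, hxt⟩

end Chains

/-! ### The interval topology, neighbourhoods of ∞, Fréchet and CFC. -/

section TreeTopology

open IsOrderTree Filter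

variable {T : Type*} [PartialOrder T] [τ : TopologicalSpace T]

theorem isOpen_Iic_of_eq (hτ : τ = treeIntervalTopology T) (t : T) : IsOpen (Set.Iic t) := by
  rw [hτ]
  exact TopologicalSpace.isOpen_generateFrom_of_mem (Or.inr ⟨t, rfl⟩)

theorem isOpen_Ioc_of_eq (hτ : τ = treeIntervalTopology T) {s t : T} (h : s < t) :
    IsOpen (Set.Ioc s t) := by
  rw [hτ]
  exact TopologicalSpace.isOpen_generateFrom_of_mem (Or.inl ⟨s, t, h, rfl⟩)

theorem nhds_treeInterval [IsOrderTree T] (hτ : τ = treeIntervalTopology T) (t : T) :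
    𝓝 t = 𝓟 (Set.Iic t) ⊓ ⨅ s ∈ Set.Iio t, 𝓟 (Set.Ioc s t) := by
  apply le_antisymm
  · refine le_inf ?_ (le_iInf₂ fun s hs => ?_)
    · exact le_principal_iff.2 ((isOpen_Iic_of_eq hτ t).mem_nhds le_rfl)
    · exact le_principal_iff.2 ((isOpen_Ioc_of_eq hτ hs).mem_nhds ⟨hs, le_rfl⟩)
  · rw [hτ, TopologicalSpace.nhds_generateFrom]
    refine le_iInf₂ fun U hU => ?_
    rcases hU with ⟨ht, ⟨s, u, hsu, rfl⟩ | ⟨u, rfl⟩⟩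
    · refine inf_le_right.trans ((iInf₂_le s ht.1).trans ?_)
      exact principal_mono.2 (Set.Ioc_subset_Ioc_right ht.2)
    · exact inf_le_left.trans (principal_mono.2 (Set.Iic_subset_Iic.2 ht))

/-- Induction on `t`: an ultrafilter on `Iic t` either contains every `Ioc s t` and converges to
`t`, or contains some smaller cone `Iic s`. -/
theorem isCompact_Iic_treeInterval [IsOrderTree T] (hτ : τ = treeIntervalTopology T) (t : T) :
    IsCompact (Set.Iic t) := by
  induction t using WellFoundedLT.induction with
  | ind t ih =>
    refine isCompact_iff_ultrafilter_le_nhds.2 fun f hf => ?_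
    by_cases h : ∀ s < t, Set.Ioc s t ∈ f
    · refine ⟨t, le_rfl, ?_⟩
      rw [nhds_treeInterval hτ]
      exact le_inf hf (le_iInf₂ fun s hs => le_principal_iff.2 (h s hs))
    · push Not at h
      obtain ⟨s, hs, hsf⟩ := h
      have hmem : Set.Iic s ∈ f := by
        filter_upwards [le_principal_iff.1 hf, Ultrafilter.compl_mem_iff_notMem.2 hsf]
          with x hx hx'
        rcases le_or_ge_of_le hx hs.le with h | h
        · exact h
        · by_contra hxs
          exact hx' ⟨lt_of_le_not_ge h hxs, hx⟩
      obtain ⟨x, hx, hfx⟩ := isCompact_iff_ultrafilter_le_nhds.1 (ih s hs) f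
        (le_principal_iff.2 hmem)
      exact ⟨x, le_trans hx hs.le, hfx⟩

/-- This is where uniqueness of limit nodes enters: a node `u` in the closure of `Iic t` but outside
it would be a limit node with all predecessors in `Iic t`, sharing them with a node of `Iic t`. -/
theorem isClosed_Iic_treeInterval [IsOrderTree T] (hlim : HasUniqueLimitNodes T)
    (hτ : τ = treeIntervalTopology T) (t : T) : IsClosed (Set.Iic t) := by
  refine ⟨isOpen_iff_mem_nhds.2 fun u hu => ?_⟩
  have hut : ¬ u ≤ t := hu
  by_cases h₀ : (Set.Iio u).Nonempty
  swap
  · filter_upwards [(isOpen_Iic_of_eq hτ u).mem_nhds le_rfl] with x hx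
    rcases (show x ≤ u from hx).eq_or_lt with rfl | hx
    exacts [hut, (h₀ ⟨x, hx⟩).elim]
  by_cases h₁ : ∃ s < u, ¬ s ≤ t
  · obtain ⟨s, hs, hst⟩ := h₁
    filter_upwards [(isOpen_Ioc_of_eq hτ hs).mem_nhds ⟨hs, le_rfl⟩] with x hx hxt
    exact hst (hx.1.le.trans hxt)
  by_cases h₂ : ∃ s < u, ∀ y < u, ¬ s < y
  · obtain ⟨s, hs, hmax⟩ := h₂
    filter_upwards [(isOpen_Ioc_of_eq hτ hs).mem_nhds ⟨hs, le_rfl⟩] with x hx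
    rcases hx.2.eq_or_lt with rfl | hxu
    exacts [hut, (hmax x hxu hx.1).elim]
  push Not at h₁ h₂
  exfalso
  have htu : t ∉ Set.Iio u := fun h => by
    obtain ⟨y, hy, hty⟩ := h₂ t h
    exact hty.not_ge (h₁ y hy)
  obtain ⟨m, ⟨hmt, hmu⟩, hmin⟩ := exists_min (A := Set.Iic t \ Set.Iio u) ⟨t, le_rfl, htu⟩
  have hIio : Set.Iio u = Set.Iio m := by
    ext x
    refine ⟨fun hx => ?_, fun hx => ?_⟩
    · rcases le_or_ge_of_le (h₁ x hx) hmt with h | h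
      · exact lt_of_le_of_ne h fun h' => hmu (h' ▸ hx)
      · exact (hmu (lt_of_le_of_lt h hx)).elim
    · by_contra hxu
      exact hmin x ⟨(le_of_lt hx).trans hmt, hxu⟩ hx
  have hlevel : level u = level m := by
    unfold level
    congr! 1 <;> rw [hIio]
  exact hut (hlim u m hlevel (isSuccLimit_level h₀ h₂) hIio ▸ hmt)

theorem nhds_infty_treeInterval [IsOrderTree T] (hlim : HasUniqueLimitNodes T)
    (hτ : τ = treeIntervalTopology T) :
    𝓝 (OnePoint.infty : OnePoint T) =
      ⨅ t : T, 𝓟 ((OnePoint.some '' Set.Iic t)ᶜ : Set (OnePoint T)) := by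
  apply le_antisymm
  · refine le_iInf fun t => le_principal_iff.2 ?_
    refine IsOpen.mem_nhds ?_ (by simp)
    exact OnePoint.isOpen_compl_image_coe.2
      ⟨isClosed_Iic_treeInterval hlim hτ t, isCompact_Iic_treeInterval hτ t⟩
  · rw [OnePoint.nhds_infty_eq]
    intro U hU
    obtain ⟨hU, hinf⟩ := mem_sup.1 hU
    obtain ⟨K, ⟨-, hK⟩, hKU⟩ := hasBasis_coclosedCompact.mem_iff.1 (mem_map.1 hU)
    obtain ⟨F, -, hF⟩ := hK.elim_nhds_subcover Set.Iic
      fun x _ => (isOpen_Iic_of_eq hτ x).mem_nhds le_rfl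
    have hmem : (⋂ t ∈ F, (OnePoint.some '' Set.Iic t)ᶜ : Set (OnePoint T)) ∈
        ⨅ t : T, 𝓟 ((OnePoint.some '' Set.Iic t)ᶜ : Set (OnePoint T)) :=
      (biInter_finset_mem F).2 fun t _ => mem_iInf_of_mem t (mem_principal_self _)
    refine mem_of_superset hmem fun x hx => ?_
    induction x using OnePoint.rec with
    | infty => exact hinf
    | coe x =>
      refine hKU fun hxK => ?_
      obtain ⟨t, ht, hxt⟩ := Set.mem_iUnion₂.1 (hF hxK)
      exact Set.mem_iInter₂.1 hx t ht ⟨x, hxt, rfl⟩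

theorem mem_nhds_infty_treeInterval [IsOrderTree T] (hlim : HasUniqueLimitNodes T)
    (hτ : τ = treeIntervalTopology T) {U : Set (OnePoint T)}
    (hU : U ∈ 𝓝 (OnePoint.infty : OnePoint T)) :
    ∃ F : Set T, F.Finite ∧ ∀ x : T, x ∉ ⋃ t ∈ F, Set.Iic t → (x : OnePoint T) ∈ U := by
  rw [nhds_infty_treeInterval hlim hτ, (hasBasis_iInf_principal_finite _).mem_iff] at hU
  obtain ⟨F, hF, hFU⟩ := hU
  refine ⟨F, hF, fun x hx => hFU (Set.mem_iInter₂.2 fun t ht => ?_)⟩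
  rintro ⟨y, hy, hyx⟩
  rw [OnePoint.coe_injective hyx] at hy
  exact hx (Set.mem_biUnion ht hy)

theorem IsAronszajnTree.isCountablyGenerated_nhds [IsOrderTree T] (hA : IsAronszajnTree T)
    (hτ : τ = treeIntervalTopology T) (t : T) :
    (𝓝 (t : OnePoint T)).IsCountablyGenerated := by
  have : (⨅ s ∈ Set.Iio t, 𝓟 (Set.Ioc s t)).IsCountablyGenerated := by
    rw [← iInf_image (f := fun s => Set.Ioc s t) (t := Set.Iio t) (g := fun U => 𝓟 U)]
    exact isCountablyGenerated_biInf_principal ((hA.countable_Iio t).image _)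
  rw [OnePoint.nhds_coe_eq, nhds_treeInterval hτ]
  infer_instance

theorem IsAronszajnTree.frechetUrysohnSpace_onePoint [IsOrderTree T] (hA : IsAronszajnTree T)
    (hlim : HasUniqueLimitNodes T) (hτ : τ = treeIntervalTopology T) :
    FrechetUrysohnSpace (OnePoint T) := by
  refine ⟨fun A x hx => ?_⟩
  induction x using OnePoint.rec with
  | coe x =>
    have := hA.isCountablyGenerated_nhds hτ x
    have := mem_closure_iff_nhdsWithin_neBot.1 hx
    obtain ⟨p, hp⟩ := exists_seq_tendsto (𝓝[A] (x : OnePoint T))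
    obtain ⟨hp₁, hp₂⟩ := tendsto_nhdsWithin_iff.1 hp
    obtain ⟨N, hN⟩ := eventually_atTop.1 hp₂
    exact ⟨fun n => p (n + N), fun n => hN _ (Nat.le_add_left _ _),
      hp₁.comp (tendsto_add_atTop_nat N)⟩
  | infty =>
    by_cases hmem : OnePoint.infty ∈ A
    · exact subset_seqClosure hmem
    obtain ⟨p, hpA, hp⟩ := hA.exists_seq_eventually_not_le (A := OnePoint.some ⁻¹' A) (by
      intro F hF hAF
      have : (⋂ t ∈ F, (OnePoint.some '' Set.Iic t)ᶜ : Set (OnePoint T)) ∈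
          𝓝 (OnePoint.infty : OnePoint T) := by
        rw [nhds_infty_treeInterval hlim hτ]
        exact (biInter_mem hF).2 fun t _ => mem_iInf_of_mem t (mem_principal_self _)
      obtain ⟨y, hy, hyA⟩ := mem_closure_iff_nhds.1 hx _ this
      induction y using OnePoint.rec with
      | infty => exact hmem hyA
      | coe y =>
        obtain ⟨t, ht, hyt⟩ := Set.mem_iUnion₂.1 (hAF hyA)
        exact Set.mem_iInter₂.1 hy t ht ⟨y, hyt, rfl⟩)
    refine ⟨fun n => p n, hpA, ?_⟩
    rw [nhds_infty_treeInterval hlim hτ]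
    refine tendsto_iInf.2 fun t => tendsto_principal.2 ?_
    filter_upwards [hp t] with n hn
    rintro ⟨y, hy, hyx⟩
    rw [OnePoint.coe_injective hyx] at hy
    exact hn hy

theorem IsAronszajnTree.isCFC_onePoint [IsOrderTree T] (hA : IsAronszajnTree T)
    (hlim : HasUniqueLimitNodes T) (hτ : τ = treeIntervalTopology T) : IsCFC (OnePoint T) := by
  intro S hS
  refine ⟨fun ⟨x, hx⟩ => ?_⟩
  rw [nhds_subtype]
  induction x using OnePoint.rec with
  | coe x =>
    have := hA.isCountablyGenerated_nhds hτ x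
    infer_instance
  | infty =>
    have hS' : (⋃ x ∈ (OnePoint.some ⁻¹' S : Set T), Set.Iic x).Countable :=
      (hS.preimage OnePoint.coe_injective).biUnion fun x _ => hA.countable_Iic x
    have hD := hA.countable_setOf_Iio_subset hS'
    set D := {t : T | Set.Iio t ⊆ ⋃ x ∈ (OnePoint.some ⁻¹' S : Set T), Set.Iic x} with hDdef
    set g : T → Set S := fun t => Subtype.val ⁻¹' (OnePoint.some '' Set.Iic t)ᶜ with hg
    have hrange : (Set.range g).Countable := by
      refine (hD.image g).mono ?_
      rintro _ ⟨t, rfl⟩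
      by_cases ht : t ∈ D
      · exact ⟨t, ht, rfl⟩
      -- The first node `m ≤ t` outside the down-closure gives the same trace: a node of `S` below
      -- `t` is comparable with `m`, and cannot be above it.
      · obtain ⟨x, hxt, hx⟩ := Set.not_subset.1 ht
        obtain ⟨m, hm, hmx, hmin⟩ := exists_min_le
          (A := (⋃ x ∈ (OnePoint.some ⁻¹' S : Set T), Set.Iic x)ᶜ) hx
        have hmt : m ≤ t := hmx.trans (le_of_lt hxt)
        refine ⟨m, fun y hy => by_contra fun hy' => hmin y hy' hy, ?_⟩
        simp only [hg]
        ext ⟨y, hy⟩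
        simp only [Set.mem_preimage, Set.mem_compl_iff, not_iff_not]
        refine ⟨fun h => Set.image_mono (Set.Iic_subset_Iic.2 hmt) h, ?_⟩
        rintro ⟨z, hz, rfl⟩
        refine ⟨z, ?_, rfl⟩
        rcases le_or_ge_of_le hz hmt with h | h
        · exact h
        · exact (hm (Set.mem_biUnion (x := z) hy h)).elim
    rw [nhds_infty_treeInterval hlim hτ, comap_iInf]
    simp only [comap_principal]
    rw [← iInf_range (f := g) (g := fun U => 𝓟 U)]
    exact isCountablyGenerated_biInf_principal hrange

end TreeTopology

/-! ### Continuous selections over countable regular domains. -/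

section Selection

open Filter

variable {Y X : Type*} [TopologicalSpace Y] [TopologicalSpace X]

theorem lowerHemicontinuousAt_iff_eventually {Φ : Y → Set X} {y : Y} :
    LowerHemicontinuousAt Φ y ↔
      ∀ U, IsOpen U → (Φ y ∩ U).Nonempty → ∀ᶠ z in 𝓝 y, (Φ z ∩ U).Nonempty := by
  refine ⟨fun h U hU hne => (h U ⟨hU, hne⟩).mono fun z hz => hz.2, fun h U hU => ?_⟩
  exact (h U hU.1 hU.2).mono fun z hz => ⟨hU.1, hz⟩

theorem exists_isClopen_subset_of_countable [T3Space Y] [Countable Y] {y : Y} {V : Set Y}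
    (hV : V ∈ 𝓝 y) : ∃ C, IsClopen C ∧ y ∈ C ∧ C ⊆ V := by
  have hcard : Cardinal.mk Y < Cardinal.continuum :=
    (Cardinal.mk_le_aleph0 (α := Y)).trans_lt Cardinal.aleph0_lt_continuum
  obtain ⟨C, hC, hy, hCV⟩ :=
    (CompletelyRegularSpace.isTopologicalBasis_clopens_of_cardinalMk_lt_continuum
      hcard).mem_nhds_iff.1 hV
  exact ⟨C, hC, hy, hCV⟩

/-- A carrier can be shrunk so that it converges to a prescribed value at one point, at the cost of
lower hemicontinuity at that point only. -/
theorem exists_shrink_of_lowerHemicontinuousAt [T3Space Y] [Countable Y]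
    [FirstCountableTopology X] {Φ : Y → Set X} (hne : ∀ y, (Φ y).Nonempty) {y₀ : Y}
    (h₀ : LowerHemicontinuousAt Φ y₀) {x : X} (hx : x ∈ Φ y₀) :
    ∃ Ψ : Y → Set X, (∀ y, (Ψ y).Nonempty) ∧ (∀ y, Ψ y ⊆ Φ y) ∧
      (∀ y, y ≠ y₀ → LowerHemicontinuousAt Φ y → LowerHemicontinuousAt Ψ y) ∧
      ∀ U ∈ 𝓝 x, ∀ᶠ y in 𝓝[≠] y₀, Ψ y ⊆ U := by
  classical
  obtain ⟨N, hN, hbasis⟩ := (nhds_basis_opens x).exists_antitone_subbasis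
  have : Nonempty Y := ⟨y₀⟩
  obtain ⟨e, he⟩ := exists_surjective_nat Y
  -- Excluding `e k` makes the intersection of all `C k` equal to `{y₀}`.
  have hC : ∀ k, ∃ C, IsClopen C ∧ y₀ ∈ C ∧ (∀ y ∈ C, (Φ y ∩ N k).Nonempty) ∧
      (e k ≠ y₀ → e k ∉ C) := by
    intro k
    have h1 : {y | (Φ y ∩ N k).Nonempty} ∈ 𝓝 y₀ :=
      lowerHemicontinuousAt_iff_eventually.1 h₀ _ (hN k).2 ⟨x, hx, (hN k).1⟩
    have h2 : {y | e k ≠ y₀ → y ≠ e k} ∈ 𝓝 y₀ := by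
      by_cases h : e k = y₀
      · simp [h]
      · filter_upwards [isOpen_ne.mem_nhds (Ne.symm h)] with y hy _ using hy
    obtain ⟨C, hC, hy, hCV⟩ := exists_isClopen_subset_of_countable (inter_mem h1 h2)
    exact ⟨C, hC, hy, fun y hy => (hCV hy).1, fun h hek => (hCV hek).2 h rfl⟩
  choose C hclopen hy₀C hCN hCe using hC
  have hex : ∀ y, y ≠ y₀ → ∃ k, y ∉ C k := by
    intro y hy
    obtain ⟨k, rfl⟩ := he y
    exact ⟨k, hCe k hy⟩
  -- The first `k` with `y ∉ C k`, locally constant off `y₀`; the default 0 occurs only at `y₀`.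
  let m : Y → ℕ := fun y => if h : ∃ k, y ∉ C k then Nat.find h else 0
  have hm₁ : ∀ y, ∀ k < m y, y ∈ C k := by
    intro y k hk
    by_cases h : ∃ k, y ∉ C k
    · simp only [m, dif_pos h] at hk
      exact not_not.1 (Nat.find_min h hk)
    · push Not at h
      exact h k
  have hm₂ : ∀ y, y ≠ y₀ → y ∉ C (m y) := by
    intro y hy
    simp only [m, dif_pos (hex y hy)]
    exact Nat.find_spec (hex y hy)
  have hm₃ : ∀ y n, (∀ k < n, y ∈ C k) → y ∉ C n → m y = n := by
    intro y n h1 h2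
    simp only [m, dif_pos (⟨n, h2⟩ : ∃ k, y ∉ C k)]
    exact (Nat.find_eq_iff _).2 ⟨h2, fun k hk => not_not.2 (h1 k hk)⟩
  have hloc : ∀ y, y ≠ y₀ → ∀ᶠ z in 𝓝 y, m z = m y := by
    intro y hy
    have h1 : ∀ᶠ z in 𝓝 y, ∀ k ∈ Set.Iio (m y), z ∈ C k :=
      (eventually_all_finite (Set.finite_Iio _)).2 fun k hk =>
        (hclopen k).isOpen.mem_nhds (hm₁ y k hk)
    filter_upwards [h1, (hclopen (m y)).compl.isOpen.mem_nhds (hm₂ y hy)] with z hz hz'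
    exact hm₃ z _ hz hz'
  -- The index is shifted because `m y = n + 1` only guarantees `y ∈ C n`, hence that `Φ y` meets `N
  -- n`.
  let R : ℕ → Set X := fun n => Nat.casesOn n Set.univ N
  have hR : ∀ n, IsOpen (R n) := by
    rintro (_ | n)
    exacts [isOpen_univ, (hN n).2]
  refine ⟨fun y => Φ y ∩ R (m y), fun y => ?_, fun y => Set.inter_subset_left,
    fun y hy hΦ => ?_, fun U hU => ?_⟩
  · beta_reduce
    rcases h : m y with _ | n
    · exact (hne y).mono (Set.subset_inter subset_rfl (Set.subset_univ _))
    · exact hCN n y (hm₁ y n (by omega))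
  · refine lowerHemicontinuousAt_iff_eventually.2 fun U hU hyU => ?_
    rw [Set.inter_assoc] at hyU
    filter_upwards [hloc y hy,
      lowerHemicontinuousAt_iff_eventually.1 hΦ _ ((hR _).inter hU) hyU] with z hz hzU
    rwa [hz, Set.inter_assoc]
  · obtain ⟨k, hk⟩ := hbasis.mem_iff.1 hU
    have h1 : ∀ᶠ z in 𝓝 y₀, ∀ i ∈ Set.Iic k, z ∈ C i :=
      (eventually_all_finite (Set.finite_Iic _)).2 fun i _ =>
        (hclopen i).isOpen.mem_nhds (hy₀C i)
    filter_upwards [nhdsWithin_le_nhds h1, self_mem_nhdsWithin] with z hz hzne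
    have hkm : k < m z := by
      by_contra! h
      exact hm₂ z hzne (hz _ h)
    obtain ⟨j, hj⟩ := Nat.exists_eq_succ_of_ne_zero (Nat.ne_zero_of_lt hkm)
    simp only [hj]
    exact Set.inter_subset_right.trans ((hbasis.antitone (by omega : k ≤ j)).trans hk)

/-- Michael's selection theorem for countable domains. -/
theorem isStronglySelective_of_countable [T3Space Y] [Countable Y] [FirstCountableTopology X] :
    IsStronglySelective Y X := by
  intro φ hne hφ
  obtain ⟨e, he⟩ := exists_injective_nat Y
  -- At stage `n`, lower hemicontinuity is kept only at the points not yet treated.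
  let State : ℕ → Type _ := fun n =>
    {Φ : Y → Set X // (∀ y, (Φ y).Nonempty) ∧ ∀ y, n ≤ e y → LowerHemicontinuousAt Φ y}
  have step : ∀ n (Φ : State n), ∃ Ψ : State (n + 1), (∀ y, Ψ.1 y ⊆ Φ.1 y) ∧
      ∀ y, e y = n → ∃ x ∈ Φ.1 y, ∀ U ∈ 𝓝 x, ∀ᶠ z in 𝓝[≠] y, Ψ.1 z ⊆ U := by
    intro n Φ
    by_cases hn : ∃ y, e y = n
    · obtain ⟨y₀, rfl⟩ := hn
      obtain ⟨x, hx⟩ := Φ.2.1 y₀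
      obtain ⟨Ψ, h1, h2, h3, h4⟩ :=
        exists_shrink_of_lowerHemicontinuousAt Φ.2.1 (Φ.2.2 y₀ le_rfl) hx
      refine ⟨⟨Ψ, h1, fun y hy => h3 y ?_ (Φ.2.2 y (by omega))⟩, h2, fun y hy => ?_⟩
      · rintro rfl
        omega
      · rw [he hy]
        exact ⟨x, hx, h4⟩
    · exact ⟨⟨Φ.1, Φ.2.1, fun y hy => Φ.2.2 y (by omega)⟩, fun y => subset_rfl,
        fun y hy => (hn ⟨y, hy⟩).elim⟩
  choose next hsub hpt using step
  let A : ∀ n, State n := fun n =>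
    Nat.rec ⟨φ, hne, fun y _ => hφ y⟩ (fun n Φ => next n Φ) n
  have hA : ∀ n, A (n + 1) = next n (A n) := fun _ => rfl
  have hanti : ∀ y, Antitone fun n => (A n).1 y := fun y =>
    antitone_nat_of_succ_le fun n => hsub n (A n) y
  choose f hf hlim using fun y => hpt (e y) (A (e y)) y rfl
  refine ⟨f, continuous_iff_continuousAt.2 fun y U hU => ?_, fun y => hanti y (Nat.zero_le _) (hf y)⟩
  -- Points treated before `y` are finitely many and can be avoided; those treated later take values
  -- in the carrier already shrunk towards `f y`.
  have hfin : {z | e z < e y}.Finite := (Set.finite_Iio (e y)).preimage he.injOn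
  have h1 := eventually_nhdsWithin_iff.1 (hlim y U hU)
  rw [mem_map]
  filter_upwards [h1, hfin.isClosed.isOpen_compl.mem_nhds (lt_irrefl (e y) : ¬ e y < e y)]
    with z hz hz'
  by_cases hzy : z = y
  · rw [hzy, Set.mem_preimage]
    exact mem_of_mem_nhds hU
  · have hlt : e y + 1 ≤ e z :=
      lt_of_le_of_ne (not_lt.1 fun h : e z < e y => hz' h) fun h => hzy (he h.symm)
    exact hz hzy (hanti z hlt (hf z))

end Selection

/-! ### Strong selectivity and the W-game on the compactified tree. -/

section OnePointTree

open IsOrderTree Filter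

variable {T : Type*} [PartialOrder T] [IsOrderTree T]

theorem Set.Countable.setOf_list {α : Type*} {C : Set α} (hC : C.Countable) :
    {l : List α | ∀ a ∈ l, a ∈ C}.Countable := by
  have : Countable C := hC.to_subtype
  refine (Set.countable_range (List.map (Subtype.val : C → α))).mono fun l hl => ?_
  exact ⟨l.attachWith (· ∈ C) hl, List.attachWith_map_subtype_val _⟩

theorem exists_countable_closed_under {α : Type*} {G : List α → Set α}
    (hG : ∀ l, (G l).Countable) :
    ∃ C : Set α, C.Countable ∧ ∀ l : List α, (∀ a ∈ l, a ∈ C) → G l ⊆ C := by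
  let next : Set α → Set α := fun C => C ∪ ⋃ l ∈ {l : List α | ∀ a ∈ l, a ∈ C}, G l
  let C : ℕ → Set α := fun n => Nat.rec ∅ (fun _ C => next C) n
  have hmono : Monotone C := monotone_nat_of_le_succ fun n => Set.subset_union_left
  refine ⟨⋃ n, C n, Set.countable_iUnion fun n => ?_, fun l hl => ?_⟩
  · induction n with
    | zero => exact Set.countable_empty
    | succ n ih =>
      refine ih.union (Set.Countable.biUnion ?_ fun l _ => hG l)
      exact ih.setOf_list
  · have : ∃ n, ∀ a ∈ l, a ∈ C n := by
      induction l with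
      | nil => exact ⟨0, by simp⟩
      | cons a l ih =>
        obtain ⟨n, hn⟩ := ih fun b hb => hl b (List.mem_cons_of_mem _ hb)
        obtain ⟨k, hk⟩ := Set.mem_iUnion.1 (hl a List.mem_cons_self)
        refine ⟨max n k, fun b hb => ?_⟩
        rcases List.mem_cons.1 hb with rfl | hb
        exacts [hmono (le_max_right _ _) hk, hmono (le_max_left _ _) (hn b hb)]
    obtain ⟨n, hn⟩ := this
    refine Set.Subset.trans ?_ (Set.subset_iUnion C (n + 1))
    exact Set.subset_union_of_subset_right
      (Set.subset_biUnion_of_mem (u := G) (show l ∈ {l : List α | ∀ a ∈ l, a ∈ C n} from hn)) _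

/-- If each `s ∈ F` missed some predecessor of `t`, the largest of these finitely many comparable
witnesses would escape every cone. -/
theorem Iio_subset_Iic_of_subset_biUnion {F : Set T} {t : T} (hne : (Set.Iio t).Nonempty)
    (hF : F.Finite) (h : Set.Iio t ⊆ ⋃ s ∈ F, Set.Iic s) : ∃ s ∈ F, Set.Iio t ⊆ Set.Iic s := by
  by_contra! hno
  have : ∀ s ∈ F, ∃ x < t, ¬ x ≤ s := fun s hs => Set.not_subset.1 (hno s hs)
  have hbound : ∃ x < t, ∀ s ∈ F, ¬ x ≤ s := by
    clear h hno
    induction F, hF using Set.Finite.induction_on with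
    | empty =>
      obtain ⟨x, hx⟩ := hne
      exact ⟨x, hx, by simp⟩
    | @insert a F _ _ ih =>
      obtain ⟨x, hx, hxF⟩ := ih fun s hs => this s (Set.mem_insert_of_mem _ hs)
      obtain ⟨y, hy, hya⟩ := this a (Set.mem_insert _ _)
      rcases le_or_ge_of_lt hx hy with h | h
      · refine ⟨y, hy, ?_⟩
        rintro s (rfl | hs)
        exacts [hya, fun h' => hxF s hs (h.trans h')]
      · refine ⟨x, hx, ?_⟩
        rintro s (rfl | hs)
        exacts [fun h' => hya (h.trans h'), hxF s hs]
  obtain ⟨x, hx, hxF⟩ := hbound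
  obtain ⟨s, hs, hxs⟩ := Set.mem_iUnion₂.1 (h hx)
  exact hxF s hs hxs

variable [τ : TopologicalSpace T]

theorem IsAronszajnTree.isStronglySelective_onePoint (hA : IsAronszajnTree T)
    (hlim : HasUniqueLimitNodes T) (hτ : τ = treeIntervalTopology T)
    {Y : Type*} [TopologicalSpace Y] [Countable Y] [T3Space Y] :
    IsStronglySelective Y (OnePoint T) := by
  intro φ hne hφ
  rw [lowerHemicontinuous_iff_isOpen_inter_nonempty] at hφ
  have hψ : ∀ y, ∃ M ⊆ (OnePoint.some ⁻¹' φ y : Set T), M.Countable ∧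
      (OnePoint.some ⁻¹' φ y ⊆ M ∨ IsAntichain (· ≤ ·) M ∧ M.Infinite) := by
    intro y
    by_cases h : IsFiniteUnionOfChains (OnePoint.some ⁻¹' φ y : Set T)
    · exact ⟨_, subset_rfl, hA.countable_of_isFiniteUnionOfChains h, Or.inl subset_rfl⟩
    · obtain ⟨M, hM, hanti, hinf⟩ := exists_infinite_antichain_of_not_isFiniteUnionOfChains h
      let e := hinf.natEmbedding M
      have he : Set.range (fun n => (e n : T)) ⊆ M := Set.range_subset_iff.2 fun n => (e n).2
      exact ⟨_, he.trans hM, Set.countable_range _, Or.inr ⟨hanti.subset he,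
        Set.infinite_range_of_injective (Subtype.val_injective.comp e.injective)⟩⟩
  choose M hMφ hMc hM using hψ
  set D : Set T := ⋃ y, ⋃ x ∈ M y, Set.Iic x with hD
  have hDc : D.Countable :=
    Set.countable_iUnion fun y => (hMc y).biUnion fun x _ => hA.countable_Iic x
  have hDopen : IsOpen D :=
    isOpen_iUnion fun y => isOpen_biUnion fun x _ => isOpen_Iic_of_eq hτ x
  have hMD : ∀ y, M y ⊆ D := fun y x hx =>
    Set.mem_iUnion.2 ⟨y, Set.mem_biUnion hx (Set.mem_Iic.2 le_rfl)⟩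
  set S : Set (OnePoint T) := insert OnePoint.infty (OnePoint.some '' D) with hS
  have hSc : S.Countable := (hDc.image _).insert _
  have hfc : FirstCountableTopology S := hA.isCFC_onePoint hlim hτ S hSc
  -- Near ∞ nothing is lost by restricting to `S`: it contains either all of `φ y` or an infinite
  -- antichain of it, which enters every neighbourhood of ∞.
  have hinfty : ∀ y, ∀ U : Set (OnePoint T), IsOpen U → OnePoint.infty ∈ U →
      (φ y ∩ U).Nonempty → (φ y ∩ (S ∩ U)).Nonempty := by
    rintro y U hU hU' ⟨x, hxφ, hxU⟩
    rcases hM y with h | ⟨hanti, hinf⟩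
    · refine ⟨x, hxφ, ?_, hxU⟩
      induction x using OnePoint.rec with
      | infty => exact Set.mem_insert _ _
      | coe x => exact Or.inr ⟨x, hMD y (h hxφ), rfl⟩
    · obtain ⟨F, hF, hFU⟩ := mem_nhds_infty_treeInterval hlim hτ (hU.mem_nhds hU')
      obtain ⟨x, hx, hxF⟩ := Set.not_subset.1 (hanti.not_subset_biUnion_Iic hinf hF)
      exact ⟨x, hMφ y hx, Or.inr ⟨x, hMD y hx, rfl⟩, hFU x hxF⟩
  let ψ : Y → Set S := fun y => Subtype.val ⁻¹' φ y
  have hψne : ∀ y, (ψ y).Nonempty := by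
    intro y
    obtain ⟨x, hx, hxS, -⟩ := hinfty y Set.univ isOpen_univ trivial (by simpa using hne y)
    exact ⟨⟨x, hxS⟩, hx⟩
  have hψ : LowerHemicontinuous ψ := by
    rw [lowerHemicontinuous_iff_isOpen_inter_nonempty]
    intro V hV
    obtain ⟨U, hU, rfl⟩ := isOpen_induced_iff.1 hV
    have hiff : ∀ y, (ψ y ∩ Subtype.val ⁻¹' U).Nonempty ↔ (φ y ∩ (S ∩ U)).Nonempty := by
      intro y
      constructor
      · rintro ⟨x, hx, hxU⟩
        exact ⟨x, hx, x.2, hxU⟩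
      · rintro ⟨x, hx, hxS, hxU⟩
        exact ⟨⟨x, hxS⟩, hx, hxU⟩
    simp only [hiff]
    by_cases hU' : OnePoint.infty ∈ U
    · convert hφ U hU using 3 with y
      exact ⟨fun h => h.mono (Set.inter_subset_inter_right _ Set.inter_subset_right),
        hinfty y U hU hU'⟩
    -- Away from ∞, restricting to `S` is harmless because `D` is open.
    · have hSU : S ∩ U = OnePoint.some '' D ∩ U := by
        ext x
        refine and_congr_left fun hxU => ⟨?_, Or.inr⟩
        rintro (rfl | hx)
        exacts [(hU' hxU).elim, hx]
      rw [hSU]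
      exact hφ _ ((OnePoint.isOpenEmbedding_coe.isOpenMap _ hDopen).inter hU)
  obtain ⟨f, hf, hfψ⟩ := isStronglySelective_of_countable ψ hψne hψ
  exact ⟨fun y => f y, continuous_subtype_val.comp hf, hfψ⟩

theorem IsAronszajnTree.not_isWSpace_onePoint (hA : IsAronszajnTree T)
    (hlim : HasUniqueLimitNodes T) (hτ : τ = treeIntervalTopology T) :
    ¬ IsWSpace (OnePoint T) := by
  intro hW
  obtain ⟨σ, hσ, hwin⟩ := hW OnePoint.infty
  -- Histories are coded as lists, so one finite set of cones serves each position regardless of its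
  -- dependent length.
  have hF : ∀ l : List T, ∃ F : Set T, F.Finite ∧ ∀ n (h : Fin n → T), List.ofFn h = l →
      ∀ x : T, x ∉ ⋃ t ∈ F, Set.Iic t → (x : OnePoint T) ∈ σ n fun i => (h i : OnePoint T) := by
    intro l
    obtain ⟨F, hF, hFσ⟩ := mem_nhds_infty_treeInterval hlim hτ
      ((hσ l.length fun i => (l.get i : OnePoint T)).1.mem_nhds (hσ _ _).2)
    refine ⟨F, hF, fun n h hl => ?_⟩
    rw [← List.ofFn_get l, List.ofFn_inj'] at hl
    cases hl
    exact hFσ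
  choose F hFfin hFσ using hF
  -- The second part puts a node into `C` once its predecessors lie below finitely many nodes of
  -- `C`; the empty list handles minimal nodes.
  let G : List T → Set T := fun l => F l ∪ {t | Set.Iio t ⊆ ⋃ s ∈ {s | s ∈ l}, Set.Iic s}
  obtain ⟨C, hCc, hC⟩ := exists_countable_closed_under (G := G) fun l =>
    (hFfin l).countable.union <| hA.countable_setOf_Iio_subset <|
      (List.finite_toSet l).countable.biUnion fun s _ => hA.countable_Iic s
  obtain ⟨t₀, ht₀⟩ : ∃ t, t ∉ C := by
    by_contra! h
    exact hA.not_countable (Set.countable_univ_iff.1 (hCc.mono fun t _ => h t))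
  obtain ⟨t, htC, hmin⟩ := exists_min (A := Cᶜ) ⟨t₀, ht₀⟩
  have hIio : Set.Iio t ⊆ C := fun x hx => by_contra fun hxC => hmin x hxC hx
  have hne : (Set.Iio t).Nonempty := by
    by_contra h
    rw [Set.not_nonempty_iff_eq_empty] at h
    exact htC (hC [] (by simp) (Or.inr (h.trans_subset (Set.empty_subset _))))
  -- If the cones of `F l` covered `Iio t`, a single `s ∈ F l ⊆ C` would bound it, and closure under
  -- `[s]` would force `t ∈ C`.
  have hmove : ∀ l : {l : List T // ∀ a ∈ l, a < t}, ∃ x < t, x ∉ ⋃ s ∈ F l.1, Set.Iic s := by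
    intro l
    by_contra! h
    obtain ⟨s, hs, hts⟩ := Iio_subset_Iic_of_subset_biUnion hne (hFfin l.1) h
    have hsC : s ∈ C := hC l.1 (fun a ha => hIio (l.2 a ha)) (Or.inl hs)
    exact htC (hC [s] (by simpa using hsC) (Or.inr (by simpa using hts)))
  choose q hqt hqF using hmove
  let play : ℕ → {l : List T // ∀ a ∈ l, a < t} := fun n =>
    Nat.rec ⟨[], by simp⟩ (fun _ l => ⟨l.1 ++ [q l], by
      intro a ha
      rcases List.mem_append.1 ha with ha | ha
      · exact l.2 a ha
      · rw [List.mem_singleton.1 ha]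
        exact hqt l⟩) n
  have hplay : ∀ n, (play n).1 = List.ofFn fun i : Fin n => q (play i) := by
    intro n
    induction n with
    | zero => rfl
    | succ n ih =>
      rw [List.ofFn_succ_last]
      change (play n).1 ++ [q (play n)] = _
      rw [ih]
      rfl
  have hconv := hwin (fun n => (q (play n) : OnePoint T)) fun n =>
    hFσ _ n (fun i => q (play i)) (hplay n).symm _ (hqF (play n))
  have hnhds : (OnePoint.some '' Set.Iic t)ᶜ ∈ 𝓝 (OnePoint.infty : OnePoint T) := by
    rw [nhds_infty_treeInterval hlim hτ]
    exact mem_iInf_of_mem t (mem_principal_self _)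
  obtain ⟨n, hn⟩ := (hconv.eventually hnhds).exists
  exact hn ⟨_, (hqt (play n)).le, rfl⟩

end OnePointTree

theorem mainTheorem9 (T : Type u) [PartialOrder T] [IsOrderTree T]
    (hA : IsAronszajnTree T) (hlim : HasUniqueLimitNodes T)
    [τ : TopologicalSpace T] (hτ : τ = treeIntervalTopology T) :
    FrechetUrysohnSpace (OnePoint T) ∧
      IsCFC (OnePoint T) ∧
      IsStronglyCSelective.{v, u} (OnePoint T) ∧
      ¬ IsWSpace (OnePoint T) :=
  ⟨hA.frechetUrysohnSpace_onePoint hlim hτ, hA.isCFC_onePoint hlim hτ,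
    fun _ _ _ _ => hA.isStronglySelective_onePoint hlim hτ, hA.not_isWSpace_onePoint hlim hτ⟩
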